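/- Let $f$ be a $\nu$-self-concordant barrier ($\nu>0$) on $\mathbb{R}^n$: a closed convex function that is $C^3$ on its open convex domain $\operatorname{dom} f$, such that every restriction $\varphi(\tau)=f(x+\tau v)$ to a line satisfies $|\varphi'''|\le 2(\varphi'')^{3/2}$, and such that $2\nabla f(x)^Tu-u^T\nabla^2 f(x)u\le\nu$ for all $x\in\operatorname{dom} f$ and $u\in\mathbb{R}^n$. Assume that $\nabla^2 f(x)\succ 0$ for all $x\in\operatorname{dom} f$, and let $g:\mathbb{R}^n\to\mathbb{R}\cup\{+\infty\}$ be proper, lower semicontinuous and convex. For $t>0$ put $F(x;t)=f(x)+t^{-1}g(x)$, $\operatorname{dom} F=\operatorname{dom} f\cap\operatorname{dom} g$, and $\|u\|_x=(u^T\nabla^2 f(x)u)^{1/2}$ for $x\in\operatorname{dom} f$. Let $t_k,t_{k+1}>0$ be such that $F(\cdot;t_k)$ and $F(\cdot;t_{k+1})$ have minimizers $x^*_{t_k}$ and $x^*_{t_{k+1}}$ in $\operatorname{dom} F$. Let $x_{t_k}\in\operatorname{dom} F$, let $\delta_k\ge 0$, and let $x_{t_{k+1}}$ be obtained from $x_{t_k}$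 by one inexact proximal-Newton step with accuracy $\delta_k$; that is, $x_{t_{k+1}}\in\operatorname{dom} F$ and $$\widehat F(x_{t_{k+1}})-\inf_{y\in\operatorname{dom} F}\widehat F(y)\le \frac{\delta_k^2}{2},$$ where $$\widehat F(y)=f(x_{t_k})+\nabla f(x_{t_k})^T(y-x_{t_k})+\tfrac12(y-x_{t_k})^T\nabla^2 f(x_{t_k})(y-x_{t_k})+t_{k+1}^{-1}g(y).$$ Set $$\lambda^+_{t_k}=\|x_{t_k}-x^*_{t_k}\|_{x^*_{t_k}},\quad \Delta_k=\|x^*_{t_{k+1}}-x^*_{t_k}\|_{x^*_{t_{k+1}}},\quad \lambda_{t_{k+1}}=\|x_{t_k}-x^*_{t_{k+1}}\|_{x^*_{t_{k+1}}},\quad \lambda^+_{t_{k+1}}=\|x_{t_{k+1}}-x^*_{t_{k+1}}\|_{x^*_{t_{k+1}}}.$$ Theorem 4.1. Let $\beta\in(0,0.15]$, and suppose that $$\delta_k\le 0.075\,\beta,\qquad \Delta_k\le\frac{\sqrt\beta-2.581\,\beta}{2.581+\sqrt\beta},\qquad \lambda^+_{t_k}\le\beta.$$ Then $$\lambda_{t_{k+1}}\le\frac{1}{2.581}\sqrt\beta\qquad\text{and}\qquad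 \lambda^+_{t_{k+1}}\le\beta.$$ In particular, $x_{t_{k+1}}$ belongs to the quadratic convergence region $\{x\in\operatorname{dom} F : \|x-x^*_{t_{k+1}}\|_{x^*_{t_{k+1}}}\le\beta\}$. -/

import Mathlib

namespace ProxNewton

/-- The real space `ℝⁿ` with its Euclidean structure. -/
abbrev Vec (n : ℕ) := EuclideanSpace ℝ (Fin n)

/-- The value `uᵀ ∇²f(x) v` of the Hessian form of `f` at `x`. -/
noncomputable def hess {n : ℕ} (f : Vec n → ℝ) (x u v : Vec n) : ℝ :=
  fderiv ℝ (fderiv ℝ f) x u v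

/-- The local norm `‖u‖_x = (uᵀ ∇²f(x) u)^{1/2}`. -/
noncomputable def localNorm {n : ℕ} (f : Vec n → ℝ) (x u : Vec n) : ℝ :=
  Real.sqrt (hess f x u u)

/-- `φ` is a standard self-concordant function of one real variable on `I`:
it is convex and `|φ'''| ≤ 2 (φ'')^{3/2}` on `I`. -/
def IsStdSelfConcordantOn (φ : ℝ → ℝ) (I : Set ℝ) : Prop :=
  ConvexOn ℝ I φ ∧
    ∀ τ ∈ I, |iteratedDeriv 3 φ τ| ≤ 2 * (iteratedDeriv 2 φ τ) ^ ((3 : ℝ) / 2)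

/-- `f`, with `dom f = D`, is self-concordant: it is a closed (lower semicontinuous) convex
function, of class `C³` on its open domain `D`, and every restriction of `f` to a line is standard
self-concordant. The values of `f` outside `D` play no role (there `f` is understood
to be `+∞`). -/
structure IsSelfConcordant {n : ℕ} (f : Vec n → ℝ) (D : Set (Vec n)) : Prop where
  isOpen_dom : IsOpen D
  convexOn : ConvexOn ℝ D f
  contDiffOn : ContDiffOn ℝ 3 f D
  isClosed_sublevel : ∀ a : ℝ, IsClosed {x | x ∈ D ∧ f x ≤ a}
  line : ∀ x ∈ D, ∀ v : Vec n,
    IsStdSelfConcordantOn (fun τ : ℝ => f (x + τ • v)) {τ : ℝ | x + τ • v ∈ D}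

/-- `f`, with `dom f = D`, is a `ν`-self-concordant barrier (for the closure of `D`):
it is self-concordant and `sup_u (2 ∇f(x)ᵀ u - ‖u‖_x²) ≤ ν` for all `x ∈ D`. -/
structure IsSelfConcordantBarrier {n : ℕ} (f : Vec n → ℝ) (D : Set (Vec n)) (ν : ℝ) : Prop where
  selfConcordant : IsSelfConcordant f D
  param_pos : 0 < ν
  barrier : ∀ x ∈ D, ∀ u : Vec n, 2 * fderiv ℝ f x u - hess f x u u ≤ ν

/-- `g : ℝⁿ → ℝ ∪ {+∞}` is proper, lower semicontinuous and convex. -/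
structure IsProperClosedConvex {n : ℕ} (g : Vec n → EReal) : Prop where
  ne_bot : ∀ x, g x ≠ ⊥
  exists_ne_top : ∃ x, g x ≠ ⊤
  lsc : LowerSemicontinuous g
  convex_epigraph : Convex ℝ {p : Vec n × ℝ | g p.1 ≤ (p.2 : EReal)}

/-- `dom F = dom f ∩ dom g`, where `dom f = D`. -/
def domF {n : ℕ} (D : Set (Vec n)) (g : Vec n → EReal) : Set (Vec n) :=
  {x | x ∈ D ∧ g x < ⊤}

/-- The objective `F(x; t) = f(x) + t⁻¹ g(x)`, used for `x ∈ dom F` only. -/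
noncomputable def objective {n : ℕ} (f : Vec n → ℝ) (g : Vec n → EReal) (t : ℝ) (x : Vec n) : ℝ :=
  f x + t⁻¹ * (g x).toReal

/-- `xs` is an exact solution `x*_t` of `min_x F(x; t)`. -/
def IsExactSolution {n : ℕ} (f : Vec n → ℝ) (D : Set (Vec n)) (g : Vec n → EReal) (t : ℝ)
    (xs : Vec n) : Prop :=
  xs ∈ domF D g ∧ ∀ y ∈ domF D g, objective f g t xs ≤ objective f g t y

/-- The second order Taylor model `Q(x; x₀)` of `f` around `x₀`. -/
noncomputable def quadModel {n : ℕ} (f : Vec n → ℝ) (x₀ x : Vec n) : ℝ :=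
  f x₀ + fderiv ℝ f x₀ (x - x₀) + 1 / 2 * hess f x₀ (x - x₀) (x - x₀)

/-- The proximal-Newton model `F̂(x; t, x₀) = Q(x; x₀) + t⁻¹ g(x)`, used for `x ∈ dom F` only. -/
noncomputable def model {n : ℕ} (f : Vec n → ℝ) (g : Vec n → EReal) (t : ℝ) (x₀ x : Vec n) : ℝ :=
  quadModel f x₀ x + t⁻¹ * (g x).toReal

/-- `xbar` is an exact solution of the subproblem `min {F̂(x; t, x₀) : x ∈ dom F}`. -/
def IsExactStep {n : ℕ} (f : Vec n → ℝ) (D : Set (Vec n)) (g : Vec n → EReal) (t : ℝ)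
    (x₀ xbar : Vec n) : Prop :=
  xbar ∈ domF D g ∧ ∀ y ∈ domF D g, model f g t x₀ xbar ≤ model f g t x₀ y

/-- `xp` is a `δ`-solution of the subproblem `min {F̂(x; t, x₀) : x ∈ dom F}`, that is, the result
of one inexact full proximal-Newton step from `x₀` with parameter `t` and accuracy `δ`: its model
value exceeds the minimum by at most `δ² / 2`. The minimum is expressed by comparison with all
points of `dom F`, so that its attainment need not be assumed;
see `isInexactStep_iff_of_isExactStep`. -/
def IsInexactStep {n : ℕ} (f : Vec n → ℝ) (D : Set (Vec n)) (g : Vec n → EReal) (t δ : ℝ)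
    (x₀ xp : Vec n) : Prop :=
  xp ∈ domF D g ∧ ∀ y ∈ domF D g, model f g t x₀ xp - model f g t x₀ y ≤ δ ^ 2 / 2

/-- In terms of the exact solution of the subproblem. -/
theorem isInexactStep_iff_of_isExactStep {n : ℕ} {f : Vec n → ℝ} {D : Set (Vec n)}
    {g : Vec n → EReal} {t δ : ℝ} {x₀ xbar xp : Vec n} (h : IsExactStep f D g t x₀ xbar) :
    IsInexactStep f D g t δ x₀ xp ↔
      xp ∈ domF D g ∧ model f g t x₀ xp - model f g t x₀ xbar ≤ δ ^ 2 / 2 := by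
  refine ⟨fun hx => ⟨hx.1, hx.2 xbar h.1⟩, fun hx => ⟨hx.1, fun y hy => ?_⟩⟩
  have h1 := h.2 y hy
  linarith [hx.2]

/-- The quadratic convergence region `{x ∈ dom F : ‖x - x*_t‖_{x*_t} ≤ β}` around the exact
solution `xs = x*_t`. -/
def quadRegion {n : ℕ} (f : Vec n → ℝ) (D : Set (Vec n)) (g : Vec n → EReal) (xs : Vec n)
    (β : ℝ) : Set (Vec n) :=
  {x | x ∈ domF D g ∧ localNorm f xs (x - xs) ≤ β}

end ProxNewton

/-! ### Binary cubic forms and bounds on symmetric trilinear forms -/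

namespace ProxNewton

/-! Self-concordance makes the Hessian stable: if `r = ‖y - x‖_x < 1`, the norms at `x` and `y`
differ by a factor of at most `1 / (1 - r)`. The hypothesis only controls `D³f[u,u,u]`, so the mixed
bound `|D³f[h,u,u]| ≤ 2 ‖h‖_x ‖u‖_x²` is needed first. In an orthonormal basis of the plane of `h`
and `u` it becomes an inequality for binary cubic forms. Integrating it along a segment gives
`hess_along_segment_bounds`.

The first estimate is the triangle inequality through the old solution, with the norm moved from the
old solution to the new one: `λ ≤ β / (1 - Δ) + Δ`. The threshold on `Δ` makes this at most `√β /
2.581`.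

For the second, the optimality of the new solution, the near-optimality of the step for the
quadratic model, and the gradient remainder bound together give an error of order `r²` plus `δ` in
the norm at the starting point, where `r` is the distance to the new solution. Since `r ≤ λ / (1 -
λ)` and `λ²` is at most about `0.15 β`, this error stays below `β (1 - λ)`. The factor `1 - λ` pays
for returning to the norm at the solution. -/

theorem sq_add_sq_le_one_of_cubic_le_one {a b c d : ℝ}
    (h : ∀ X Y : ℝ, X ^ 2 + Y ^ 2 = 1 →
      a * X ^ 3 + 3 * b * X ^ 2 * Y + 3 * c * X * Y ^ 2 + d * Y ^ 3 ≤ 1) :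
    a ^ 2 + b ^ 2 ≤ 1 := by
  -- With `X = cos θ`, `Y = sin θ`, the form is `a cos 3θ + b sin 3θ` plus a remainder, and the
  -- first part has amplitude `M = ‖a + bi‖`.
  set z : ℂ := ⟨a, b⟩
  set M : ℝ := ‖z‖
  set α : ℝ := z.arg
  have ha : M * Real.cos α = a := Complex.norm_mul_cos_arg z
  have hb : M * Real.sin α = b := Complex.norm_mul_sin_arg z
  have hM0 : 0 ≤ M := norm_nonneg z
  have hMab : a ^ 2 + b ^ 2 = M ^ 2 := by
    rw [← ha, ← hb]
    linear_combination M ^ 2 * Real.cos_sq_add_sin_sq α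
  -- At an angle `θ` with `3 θ ≡ α`, the form is `M` plus `Y ^ 2` times a linear form.
  have key : ∀ X Y : ℝ, X ^ 2 + Y ^ 2 = 1 → 4 * X ^ 3 - 3 * X = Real.cos α →
      3 * Y - 4 * Y ^ 3 = Real.sin α → 0 ≤ 3 * (c + a) * X + (d + b) * Y → M ≤ 1 := by
    intro X Y h1 hc hs hl
    have h2 := h X Y h1
    have h3 : a * X ^ 3 + 3 * b * X ^ 2 * Y + 3 * c * X * Y ^ 2 + d * Y ^ 3
        = M + Y ^ 2 * (3 * (c + a) * X + (d + b) * Y) := by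
      have e1 : X ^ 3 - 3 * X * Y ^ 2 = Real.cos α := by
        linear_combination hc - 3 * X * h1
      have e2 : 3 * X ^ 2 * Y - Y ^ 3 = Real.sin α := by
        linear_combination hs + 3 * Y * h1
      have e3 : a * Real.cos α + b * Real.sin α = M := by
        rw [← ha, ← hb]
        linear_combination M * Real.cos_sq_add_sin_sq α
      linear_combination a * e1 + b * e2 + e3
    have h4 : 0 ≤ Y ^ 2 * (3 * (c + a) * X + (d + b) * Y) := mul_nonneg (sq_nonneg _) hl
    linarith
  set X := Real.cos (α / 3)
  set Y := Real.sin (α / 3)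
  have h1 : X ^ 2 + Y ^ 2 = 1 := Real.cos_sq_add_sin_sq _
  have hc : 4 * X ^ 3 - 3 * X = Real.cos α := by
    rw [← Real.cos_three_mul]; congr 1; ring
  have hs : 3 * Y - 4 * Y ^ 3 = Real.sin α := by
    rw [← Real.sin_three_mul]; congr 1; ring
  obtain ⟨r, hr⟩ : ∃ r : ℝ, r ^ 2 = 3 := ⟨√3, Real.sq_sqrt (by norm_num)⟩
  have hM : M ≤ 1 := by
    -- Rotation by `±2π/3` preserves `3θ` modulo `2π`. The three rotated points sum to zero, so the
    -- linear form in the remainder is nonnegative at one of them.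
    have rot : ∀ ρ : ℝ, ρ ^ 2 = 3 →
        0 ≤ 3 * (c + a) * (-X / 2 - ρ / 2 * Y) + (d + b) * (-Y / 2 + ρ / 2 * X) → M ≤ 1 := by
      intro ρ hρ hl
      refine key (-X / 2 - ρ / 2 * Y) (-Y / 2 + ρ / 2 * X) ?_ ?_ ?_ hl
      · linear_combination h1 + (X ^ 2 + Y ^ 2) / 4 * hρ
      · have hX : Y ^ 2 = 1 - X ^ 2 := by linarith
        rw [← hc]
        linear_combination (-(3 * X * Y ^ 2 / 2) - ρ * Y ^ 3 / 2) * hρ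
          + (-3 / 2 * ρ * Y - 9 / 2 * X) * h1
      · rw [← hs]
        linear_combination (3 * Y * X ^ 2 / 2 - ρ * X ^ 3 / 2) * hρ
          + (9 / 2 * Y - 3 / 2 * ρ * X) * h1
    by_cases c0 : 0 ≤ 3 * (c + a) * X + (d + b) * Y
    · exact key X Y h1 hc hs c0
    by_cases c1 : 0 ≤ 3 * (c + a) * (-X / 2 - r / 2 * Y) + (d + b) * (-Y / 2 + r / 2 * X)
    · exact rot r hr c1
    · refine rot (-r) (by linarith [neg_sq r]) ?_
      linarith
  nlinarith

variable {E : Type*} [NormedAddCommGroup E] [NormedSpace ℝ E]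

/-- Normalise `u` to `e` and complete it to an `H`-orthonormal pair `e, e'` spanning `h`. The cubic
lemma bounds the vector `(T e e e, T e' e e)` by `2`, and Cauchy–Schwarz in the plane concludes. -/
theorem trilinear_le_of_diagonal_le {H : E →L[ℝ] E →L[ℝ] ℝ} {T : E →L[ℝ] E →L[ℝ] E →L[ℝ] ℝ}
    (Hsymm : ∀ u v, H u v = H v u) (Hpos : ∀ u, u ≠ 0 → 0 < H u u)
    (T12 : ∀ u v w, T u v w = T v u w) (T23 : ∀ u v w, T u v w = T u w v)
    (hT : ∀ u, |T u u u| ≤ 2 * √(H u u) ^ 3) (h u : E) :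
    T h u u ≤ 2 * √(H h h) * H u u := by
  rcases eq_or_ne u 0 with rfl | hu
  · simp
  set N := √(H u u)
  have hN : 0 < N := Real.sqrt_pos.2 (Hpos u hu)
  have hNN : N ^ 2 = H u u := Real.sq_sqrt (Hpos u hu).le
  clear_value N
  obtain ⟨e, rfl⟩ : ∃ e, u = N • e := ⟨N⁻¹ • u, by rw [smul_inv_smul₀ hN.ne']⟩
  have hee : H e e = 1 := by
    simp only [map_smul, smul_apply, smul_eq_mul] at hNN
    have : N ^ 2 * (H e e - 1) = 0 := by linear_combination -hNN
    have := (mul_eq_zero.1 this).resolve_left (by positivity)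
    linarith
  rw [← hNN]
  simp only [map_smul, smul_apply, smul_eq_mul]
  suffices hs : T h e e ≤ 2 * √(H h h) by nlinarith [mul_le_mul_of_nonneg_left hs (sq_nonneg N)]
  obtain ⟨w, hw⟩ : ∃ w, h = (H h e) • e + w := ⟨h - (H h e) • e, by abel⟩
  set α := H h e
  have hwe : H w e = 0 := by
    have : H h e = α * H e e + H w e := by
      conv_lhs => rw [hw]
      simp
    rw [hee] at this
    linarith
  have hew : H e w = 0 := by rw [Hsymm]; exact hwe
  rcases eq_or_ne w 0 with rfl | hw0
  · have h1 : T h e e = α * T e e e := by rw [hw]; simp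
    have h2 : H h h = α ^ 2 := by rw [hw]; simp [hee]; ring
    have h3 := hT e
    rw [hee] at h3
    simp only [Real.sqrt_one, one_pow, mul_one] at h3
    rw [h1, h2, Real.sqrt_sq_eq_abs]
    calc α * T e e e ≤ |α * T e e e| := le_abs_self _
      _ = |α| * |T e e e| := abs_mul _ _
      _ ≤ |α| * 2 := by gcongr
      _ = 2 * |α| := by ring
  · set K := √(H w w)
    have hK : 0 < K := Real.sqrt_pos.2 (Hpos w hw0)
    have hKK : K ^ 2 = H w w := Real.sq_sqrt (Hpos w hw0).le
    clear_value K
    obtain ⟨e', rfl⟩ : ∃ e', w = K • e' := ⟨K⁻¹ • w, by rw [smul_inv_smul₀ hK.ne']⟩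
    have hee' : H e' e' = 1 := by
      simp only [map_smul, smul_apply, smul_eq_mul] at hKK
      have : K ^ 2 * (H e' e' - 1) = 0 := by linear_combination -hKK
      have := (mul_eq_zero.1 this).resolve_left (by positivity)
      linarith
    have h12 : H e e' = 0 := by
      simp only [map_smul, smul_eq_mul] at hew
      exact (mul_eq_zero.1 hew).resolve_left hK.ne'
    have h21 : H e' e = 0 := by rw [Hsymm]; exact h12
    have hab := sq_add_sq_le_one_of_cubic_le_one (a := T e e e / 2) (b := T e' e e / 2)
      (c := T e' e' e / 2) (d := T e' e' e' / 2) (by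
        intro X Y hXY
        have h1 := (le_abs_self _).trans (hT (X • e + Y • e'))
        have h2 : H (X • e + Y • e') (X • e + Y • e') = 1 := by
          simp [hee, hee', h12, h21]
          linarith
        rw [h2] at h1
        simp only [Real.sqrt_one, one_pow, mul_one, map_add, map_smul,
          add_apply, smul_apply, smul_eq_mul] at h1
        rw [T23 e e e', T12 e e' e, T23 e e' e', T12 e e' e', T23 e' e e'] at h1
        linarith)
    have h1 : T h e e = α * T e e e + K * T e' e e := by rw [hw]; simp
    have h2 : H h h = α ^ 2 + K ^ 2 := by
      rw [hw]; simp [hee, hee', h12, h21]; ring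
    rw [h1, h2]
    have h3 : (α * T e e e / 2 + K * T e' e e / 2) ≤ √(α ^ 2 + K ^ 2) := by
      apply Real.le_sqrt_of_sq_le
      nlinarith [sq_nonneg (α * (T e' e e / 2) - K * (T e e e / 2)),
        mul_le_mul_of_nonneg_left hab (by positivity : 0 ≤ α ^ 2 + K ^ 2)]
    linarith

theorem abs_trilinear_le_of_diagonal_le {H : E →L[ℝ] E →L[ℝ] ℝ}
    {T : E →L[ℝ] E →L[ℝ] E →L[ℝ] ℝ}
    (Hsymm : ∀ u v, H u v = H v u) (Hpos : ∀ u, u ≠ 0 → 0 < H u u)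
    (T12 : ∀ u v w, T u v w = T v u w) (T23 : ∀ u v w, T u v w = T u w v)
    (hT : ∀ u, |T u u u| ≤ 2 * √(H u u) ^ 3) (h u : E) :
    |T h u u| ≤ 2 * √(H h h) * H u u := by
  refine abs_le'.2 ⟨trilinear_le_of_diagonal_le Hsymm Hpos T12 T23 hT h u, ?_⟩
  simpa using trilinear_le_of_diagonal_le Hsymm Hpos T12 T23 hT (-h) u

/-- Cauchy–Schwarz for a symmetric form `B` dominated by a positive definite form `H`. -/
theorem abs_apply_le_of_abs_diagonal_le {H B : E →L[ℝ] E →L[ℝ] ℝ} {κ : ℝ}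
    (Hsymm : ∀ u v, H u v = H v u) (Hpos : ∀ u, u ≠ 0 → 0 < H u u)
    (Bsymm : ∀ u v, B u v = B v u) (hB : ∀ u, |B u u| ≤ κ * H u u) (u v : E) :
    |B u v| ≤ κ * √(H u u) * √(H v v) := by
  rcases eq_or_ne u 0 with rfl | hu
  · simp
  rcases eq_or_ne v 0 with rfl | hv
  · simp
  have hP : 0 < √(H u u) := Real.sqrt_pos.2 (Hpos u hu)
  have hQ : 0 < √(H v v) := Real.sqrt_pos.2 (Hpos v hv)
  have hPP : √(H u u) ^ 2 = H u u := Real.sq_sqrt (Hpos u hu).le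
  have hQQ : √(H v v) ^ 2 = H v v := Real.sq_sqrt (Hpos v hv).le
  generalize √(H u u) = P at *
  generalize √(H v v) = Q at *
  -- Polarization; the weights give both terms the same `H`-norm `P * Q`.
  have h1 := abs_le.1 (hB (Q • u + P • v))
  have h2 := abs_le.1 (hB (Q • u - P • v))
  simp only [map_add, map_sub, map_smul, add_apply,
    sub_apply, smul_apply, smul_eq_mul] at h1 h2
  rw [Bsymm v u, Hsymm v u, ← hPP, ← hQQ] at h1 h2
  have hPQ : 0 < P * Q := mul_pos hP hQ
  rw [abs_le]
  constructor
  · by_contra hc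
    have := mul_lt_mul_of_pos_left (not_le.1 hc) hPQ
    linarith [h1.1, h2.2]
  · by_contra hc
    have := mul_lt_mul_of_pos_left (not_le.1 hc) hPQ
    linarith [h1.2, h2.1]

theorem sqrt_apply_add_le {H : E →L[ℝ] E →L[ℝ] ℝ}
    (Hsymm : ∀ u v, H u v = H v u) (Hpos : ∀ u, u ≠ 0 → 0 < H u u) (u v : E) :
    √(H (u + v) (u + v)) ≤ √(H u u) + √(H v v) := by
  have Hnn : ∀ u, 0 ≤ H u u := fun u => by
    rcases eq_or_ne u 0 with rfl | hu
    · simp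
    · exact (Hpos u hu).le
  have h1 := (le_abs_self _).trans (abs_apply_le_of_abs_diagonal_le (B := H) (κ := 1) Hsymm Hpos
    Hsymm (fun u => by rw [abs_of_nonneg (Hnn u), one_mul]) u v)
  refine Real.sqrt_le_iff.2 ⟨by positivity, ?_⟩
  simp only [map_add, add_apply]
  rw [Hsymm v u]
  nlinarith [Real.sq_sqrt (Hnn u), Real.sq_sqrt (Hnn v)]

/-! ### Derivatives along lines and symmetry of the third derivative -/

section Line

variable {E F : Type*} [NormedAddCommGroup E] [NormedSpace ℝ E]
  [NormedAddCommGroup F] [NormedSpace ℝ F]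

theorem hasDerivAt_comp_line {G : E → F} {x h : E} {τ : ℝ}
    (hG : DifferentiableAt ℝ G (x + τ • h)) :
    HasDerivAt (fun s : ℝ => G (x + s • h)) (fderiv ℝ G (x + τ • h) h) τ := by
  have h1 : HasDerivAt (fun s : ℝ => x + s • h) h τ := by
    simpa using ((hasDerivAt_id τ).smul_const h).const_add x
  exact hG.hasFDerivAt.comp_hasDerivAt τ h1

theorem hasDerivAt_comp_line_apply {G : E → E →L[ℝ] F} {x h u : E} {τ : ℝ}
    (hG : DifferentiableAt ℝ G (x + τ • h)) :
    HasDerivAt (fun s : ℝ => G (x + s • h) u) (fderiv ℝ G (x + τ • h) h u) τ := by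
  simpa using (hasDerivAt_comp_line hG).clm_apply (hasDerivAt_const τ u)

theorem hasDerivAt_comp_line_apply_apply {G : E → E →L[ℝ] E →L[ℝ] F} {x h u v : E} {τ : ℝ}
    (hG : DifferentiableAt ℝ G (x + τ • h)) :
    HasDerivAt (fun s : ℝ => G (x + s • h) u v) (fderiv ℝ G (x + τ • h) h u v) τ := by
  simpa using (hasDerivAt_comp_line_apply (u := u) hG).clm_apply (hasDerivAt_const τ v)

theorem isOpen_preimage_line {D : Set E} (hD : IsOpen D) (x h : E) :
    IsOpen {τ : ℝ | x + τ • h ∈ D} :=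
  hD.preimage (by fun_prop : Continuous fun τ : ℝ => x + τ • h)

variable {f : E → ℝ} {D : Set E}

theorem contDiffAt_fderiv (hD : IsOpen D) (hf : ContDiffOn ℝ 3 f D) {x : E} (hx : x ∈ D) :
    ContDiffAt ℝ 2 (fderiv ℝ f) x :=
  (hf.contDiffAt (hD.mem_nhds hx)).fderiv_right (by norm_num)

theorem contDiffAt_fderiv_fderiv (hD : IsOpen D) (hf : ContDiffOn ℝ 3 f D) {x : E}
    (hx : x ∈ D) : ContDiffAt ℝ 1 (fderiv ℝ (fderiv ℝ f)) x :=
  (contDiffAt_fderiv hD hf hx).fderiv_right (by norm_num)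

theorem differentiableAt_of_contDiffOn_three (hD : IsOpen D) (hf : ContDiffOn ℝ 3 f D) {x : E}
    (hx : x ∈ D) : DifferentiableAt ℝ f x ∧ DifferentiableAt ℝ (fderiv ℝ f) x ∧
      DifferentiableAt ℝ (fderiv ℝ (fderiv ℝ f)) x :=
  ⟨(hf.contDiffAt (hD.mem_nhds hx)).differentiableAt (by norm_num),
    (contDiffAt_fderiv hD hf hx).differentiableAt (by norm_num),
    (contDiffAt_fderiv_fderiv hD hf hx).differentiableAt (by norm_num)⟩

theorem fderiv_fderiv_symm (hD : IsOpen D) (hf : ContDiffOn ℝ 3 f D) {x : E} (hx : x ∈ D)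
    (u v : E) : fderiv ℝ (fderiv ℝ f) x u v = fderiv ℝ (fderiv ℝ f) x v u :=
  (hf.contDiffAt (hD.mem_nhds hx)).isSymmSndFDerivAt (by simp; norm_num) u v

theorem third_fderiv_symm_left (hD : IsOpen D) (hf : ContDiffOn ℝ 3 f D) {x : E} (hx : x ∈ D)
    (u v w : E) : fderiv ℝ (fderiv ℝ (fderiv ℝ f)) x u v w =
      fderiv ℝ (fderiv ℝ (fderiv ℝ f)) x v u w :=
  congrArg (fun l : E →L[ℝ] ℝ => l w)
    ((contDiffAt_fderiv hD hf hx).isSymmSndFDerivAt (by simp) u v)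

/-- The symmetry of the Hessian near `x` is differentiated in the direction `u`. -/
theorem third_fderiv_symm_right (hD : IsOpen D) (hf : ContDiffOn ℝ 3 f D) {x : E} (hx : x ∈ D)
    (u v w : E) : fderiv ℝ (fderiv ℝ (fderiv ℝ f)) x u v w =
      fderiv ℝ (fderiv ℝ (fderiv ℝ f)) x u w v := by
  have hx0 : x + (0 : ℝ) • u ∈ D := by simpa using hx
  have hd := (differentiableAt_of_contDiffOn_three hD hf hx0).2.2
  have h1 := hasDerivAt_comp_line_apply_apply (u := v) (v := w) hd
  have h2 := hasDerivAt_comp_line_apply_apply (u := w) (v := v) hd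
  have h3 := h1.unique (h2.congr_of_eventuallyEq (by
    filter_upwards [(isOpen_preimage_line hD x u).mem_nhds hx0] with τ hτ
    exact fderiv_fderiv_symm hD hf hτ v w))
  simpa using h3

theorem iteratedDeriv_comp_line (hD : IsOpen D) (hf : ContDiffOn ℝ 3 f D) {x : E} (hx : x ∈ D)
    (u : E) : iteratedDeriv 2 (fun τ : ℝ => f (x + τ • u)) 0 = fderiv ℝ (fderiv ℝ f) x u u ∧
      iteratedDeriv 3 (fun τ : ℝ => f (x + τ • u)) 0 =
        fderiv ℝ (fderiv ℝ (fderiv ℝ f)) x u u u := by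
  have hO := isOpen_preimage_line hD x u
  have hx0 : x + (0 : ℝ) • u ∈ D := by simpa using hx
  have e1 : ∀ τ ∈ {τ : ℝ | x + τ • u ∈ D},
      iteratedDeriv 1 (fun τ : ℝ => f (x + τ • u)) τ = fderiv ℝ f (x + τ • u) u := by
    intro τ hτ
    rw [iteratedDeriv_one]
    exact (hasDerivAt_comp_line (differentiableAt_of_contDiffOn_three hD hf hτ).1).deriv
  have e2 : ∀ τ ∈ {τ : ℝ | x + τ • u ∈ D},
      iteratedDeriv 2 (fun τ : ℝ => f (x + τ • u)) τ =
        fderiv ℝ (fderiv ℝ f) (x + τ • u) u u := by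
    intro τ hτ
    rw [iteratedDeriv_succ,
      ((Set.EqOn.eventuallyEq_of_mem e1 (hO.mem_nhds hτ))).deriv_eq]
    exact (hasDerivAt_comp_line_apply (differentiableAt_of_contDiffOn_three hD hf hτ).2.1).deriv
  refine ⟨by simpa using e2 0 hx0, ?_⟩
  rw [iteratedDeriv_succ, ((Set.EqOn.eventuallyEq_of_mem e2 (hO.mem_nhds hx0))).deriv_eq]
  simpa using (hasDerivAt_comp_line_apply_apply (u := u) (v := u)
    (differentiableAt_of_contDiffOn_three hD hf hx0).2.2).deriv

end Line

/-! ### Stability of the local norm of a self-concordant function -/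

section SelfConcordant

variable {n : ℕ} {f : Vec n → ℝ} {D : Set (Vec n)}

theorem abs_third_fderiv_le (hf : IsSelfConcordant f D)
    (hpos : ∀ x ∈ D, ∀ u : Vec n, u ≠ 0 → 0 < hess f x u u) {x : Vec n} (hx : x ∈ D)
    (h u : Vec n) :
    |fderiv ℝ (fderiv ℝ (fderiv ℝ f)) x h u u| ≤ 2 * localNorm f x h * hess f x u u := by
  refine abs_trilinear_le_of_diagonal_le (H := fderiv ℝ (fderiv ℝ f) x)
    (fderiv_fderiv_symm hf.isOpen_dom hf.contDiffOn hx) (hpos x hx)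
    (third_fderiv_symm_left hf.isOpen_dom hf.contDiffOn hx)
    (third_fderiv_symm_right hf.isOpen_dom hf.contDiffOn hx) (fun v => ?_) h u
  have h1 := (hf.line x hx v).2 0 (by simpa using hx)
  obtain ⟨e2, e3⟩ := iteratedDeriv_comp_line hf.isOpen_dom hf.contDiffOn hx v
  rw [e2, e3] at h1
  refine h1.trans_eq ?_
  have hnn : 0 ≤ fderiv ℝ (fderiv ℝ f) x v v := by
    rcases eq_or_ne v 0 with rfl | hv
    · simp
    · exact (hpos x hx v hv).le
  rw [Real.sqrt_eq_rpow, ← Real.rpow_natCast, ← Real.rpow_mul hnn]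
  norm_num

theorem hess_self_nonneg (hpos : ∀ x ∈ D, ∀ u : Vec n, u ≠ 0 → 0 < hess f x u u) {x : Vec n}
    (hx : x ∈ D) (u : Vec n) : 0 ≤ hess f x u u := by
  rcases eq_or_ne u 0 with rfl | hu
  · simp [hess]
  · exact (hpos x hx u hu).le

theorem localNorm_smul (f : Vec n → ℝ) (x u : Vec n) (s : ℝ) :
    localNorm f x (s • u) = |s| * localNorm f x u := by
  have : hess f x (s • u) (s • u) = s ^ 2 * hess f x u u := by
    simp [hess]; ring
  rw [localNorm, this, Real.sqrt_mul (sq_nonneg s), Real.sqrt_sq_eq_abs, localNorm]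

theorem localNorm_sub_comm (f : Vec n → ℝ) (x u v : Vec n) :
    localNorm f x (u - v) = localNorm f x (v - u) := by
  have := localNorm_smul f x (v - u) (-1)
  simpa using this

/-- Self-concordance along the segment says that `1 / ‖h‖_{x+sh}` has derivative at least `-1`, so
`1 / ‖h‖_{x+sh} + s` is nondecreasing. -/
theorem localNorm_along_segment_le (hf : IsSelfConcordant f D)
    (hpos : ∀ x ∈ D, ∀ u : Vec n, u ≠ 0 → 0 < hess f x u u) {x h : Vec n} (hx : x ∈ D)
    (hxh : x + h ∈ D) (hr : localNorm f x h < 1) {τ : ℝ} (hτ : τ ∈ Set.Icc (0 : ℝ) 1) :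
    localNorm f (x + τ • h) h * (1 - localNorm f x h * τ) ≤ localNorm f x h := by
  rcases eq_or_ne h 0 with rfl | hh
  · simp [localNorm, hess]
  have hseg : ∀ s ∈ Set.Icc (0 : ℝ) 1, x + s • h ∈ D := fun s hs =>
    hf.convexOn.1.add_smul_mem hx hxh hs
  have hp : ∀ s ∈ Set.Icc (0 : ℝ) 1, 0 < hess f (x + s • h) h h := fun s hs =>
    hpos _ (hseg s hs) h hh
  have hd : ∀ s ∈ Set.Icc (0 : ℝ) 1, HasDerivAt (fun s => (localNorm f (x + s • h) h)⁻¹ + s)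
      (-(fderiv ℝ (fderiv ℝ (fderiv ℝ f)) (x + s • h) h h h /
        (2 * localNorm f (x + s • h) h)) / localNorm f (x + s • h) h ^ 2 + 1) s := by
    intro s hs
    have h1 := hasDerivAt_comp_line_apply_apply (u := h) (v := h)
      (differentiableAt_of_contDiffOn_three hf.isOpen_dom hf.contDiffOn (hseg s hs)).2.2
    exact ((h1.sqrt (hp s hs).ne').fun_inv (Real.sqrt_pos.2 (hp s hs)).ne').add (hasDerivAt_id s)
  have hmono : MonotoneOn (fun s : ℝ => (localNorm f (x + s • h) h)⁻¹ + s) (Set.Icc 0 1) := by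
    refine monotoneOn_of_deriv_nonneg (convex_Icc 0 1)
      (fun s hs => (hd s hs).continuousAt.continuousWithinAt)
      (fun s hs => (hd s (interior_subset hs)).differentiableAt.differentiableWithinAt)
      fun s hs => ?_
    have hs' := interior_subset hs
    rw [(hd s hs').deriv]
    have h1 := (abs_le.1 (abs_third_fderiv_le hf hpos (hseg s hs') h h)).2
    have hN : 0 < localNorm f (x + s • h) h := Real.sqrt_pos.2 (hp s hs')
    have hNN : localNorm f (x + s • h) h ^ 2 = hess f (x + s • h) h h :=
      Real.sq_sqrt (hp s hs').le
    rw [← hNN] at h1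
    have h2 : fderiv ℝ (fderiv ℝ (fderiv ℝ f)) (x + s • h) h h h /
        (2 * localNorm f (x + s • h) h) / localNorm f (x + s • h) h ^ 2 ≤ 1 := by
      rw [div_div, div_le_one (by positivity)]
      linarith
    rw [neg_div]
    linarith
  have h1 := hmono (Set.left_mem_Icc.2 zero_le_one) hτ hτ.1
  simp only [zero_smul, add_zero] at h1
  have hN : 0 < localNorm f (x + τ • h) h := Real.sqrt_pos.2 (hp τ hτ)
  have hr0 : 0 < localNorm f x h := Real.sqrt_pos.2 (hpos x hx h hh)
  generalize localNorm f (x + τ • h) h = N at *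
  generalize localNorm f x h = r at *
  have h2 := mul_le_mul_of_nonneg_left h1 (mul_pos hN hr0).le
  have e1 : N * r * r⁻¹ = N := by field_simp
  have e2 : N * r * (N⁻¹ + τ) = r + N * r * τ := by field_simp
  rw [e1, e2] at h2
  linarith

/-- For `q s = ‖u‖²_{x+sh}` and `r = ‖h‖_x`, the mixed bound gives `|q'| ≤ 2r / (1 - rs) * q`. Hence
`q (1 - rs)²` is nonincreasing and `q / (1 - rs)²` is nondecreasing. -/
theorem hess_along_segment_bounds (hf : IsSelfConcordant f D)
    (hpos : ∀ x ∈ D, ∀ u : Vec n, u ≠ 0 → 0 < hess f x u u) {x h : Vec n} (hx : x ∈ D)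
    (hxh : x + h ∈ D) (hr : localNorm f x h < 1) {τ : ℝ} (hτ : τ ∈ Set.Icc (0 : ℝ) 1)
    (u : Vec n) :
    hess f (x + τ • h) u u * (1 - localNorm f x h * τ) ^ 2 ≤ hess f x u u ∧
      hess f x u u * (1 - localNorm f x h * τ) ^ 2 ≤ hess f (x + τ • h) u u := by
  have hseg : ∀ s ∈ Set.Icc (0 : ℝ) 1, x + s • h ∈ D := fun s hs =>
    hf.convexOn.1.add_smul_mem hx hxh hs
  have hN : ∀ s ∈ Set.Icc (0 : ℝ) 1, localNorm f (x + s • h) h * (1 - localNorm f x h * s) ≤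
      localNorm f x h := fun s hs => localNorm_along_segment_le hf hpos hx hxh hr hs
  have hr0 : 0 ≤ localNorm f x h := Real.sqrt_nonneg _
  generalize localNorm f x h = r at *
  have hlt : ∀ s ∈ Set.Icc (0 : ℝ) 1, 0 < 1 - r * s := fun s hs => by
    nlinarith [hs.1, hs.2]
  set q : ℝ → ℝ := fun s => hess f (x + s • h) u u
  set q' : ℝ → ℝ := fun s => fderiv ℝ (fderiv ℝ (fderiv ℝ f)) (x + s • h) h u u
  have hq : ∀ s ∈ Set.Icc (0 : ℝ) 1, HasDerivAt q (q' s) s := fun s hs =>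
    hasDerivAt_comp_line_apply_apply
      (differentiableAt_of_contDiffOn_three hf.isOpen_dom hf.contDiffOn (hseg s hs)).2.2
  have hq0 : ∀ s ∈ Set.Icc (0 : ℝ) 1, 0 ≤ q s := fun s hs => hess_self_nonneg hpos (hseg s hs) u
  have hq' : ∀ s ∈ Set.Icc (0 : ℝ) 1, |q' s * (1 - r * s)| ≤ 2 * r * q s := fun s hs => by
    rw [abs_mul, abs_of_pos (hlt s hs)]
    have h1 := abs_third_fderiv_le hf hpos (hseg s hs) h u
    calc |q' s| * (1 - r * s)
        ≤ 2 * localNorm f (x + s • h) h * q s * (1 - r * s) :=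
          mul_le_mul_of_nonneg_right h1 (hlt s hs).le
      _ = 2 * (localNorm f (x + s • h) h * (1 - r * s)) * q s := by ring
      _ ≤ 2 * r * q s :=
          mul_le_mul_of_nonneg_right (by linarith [hN s hs]) (hq0 s hs)
  have hl : ∀ s : ℝ, HasDerivAt (fun s : ℝ => 1 - r * s) (-r) s := fun s => by
    simpa using ((hasDerivAt_id s).const_mul r).const_sub 1
  have h0 : q 0 = hess f x u u := by simp [q]
  rw [← h0]
  change q τ * _ ≤ q 0 ∧ q 0 * _ ≤ q τ
  constructor
  · have hd : ∀ s ∈ Set.Icc (0 : ℝ) 1, HasDerivAt (fun s => q s * (1 - r * s) ^ 2) _ s :=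
      fun s hs => (hq s hs).mul ((hl s).fun_pow 2)
    have hanti : AntitoneOn (fun s => q s * (1 - r * s) ^ 2) (Set.Icc 0 1) := by
      refine antitoneOn_of_deriv_nonpos (convex_Icc 0 1)
        (fun s hs => (hd s hs).continuousAt.continuousWithinAt)
        (fun s hs => (hd s (interior_subset hs)).differentiableAt.differentiableWithinAt)
        fun s hs => ?_
      have hs' := interior_subset hs
      rw [(hd s hs').deriv]
      have h1 := (abs_le.1 (hq' s hs')).2
      have h2 := mul_le_mul_of_nonneg_right h1 (hlt s hs').le
      norm_num
      linarith
    have h1 := hanti (Set.left_mem_Icc.2 zero_le_one) hτ hτ.1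
    simpa using h1
  · have hd : ∀ s ∈ Set.Icc (0 : ℝ) 1, HasDerivAt (fun s => q s / (1 - r * s) ^ 2) _ s :=
      fun s hs => (hq s hs).div ((hl s).fun_pow 2) (pow_pos (hlt s hs) 2).ne'
    have hmono : MonotoneOn (fun s => q s / (1 - r * s) ^ 2) (Set.Icc 0 1) := by
      refine monotoneOn_of_deriv_nonneg (convex_Icc 0 1)
        (fun s hs => (hd s hs).continuousAt.continuousWithinAt)
        (fun s hs => (hd s (interior_subset hs)).differentiableAt.differentiableWithinAt)
        fun s hs => ?_
      have hs' := interior_subset hs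
      rw [(hd s hs').deriv]
      have h1 := (abs_le.1 (hq' s hs')).1
      have h2 := mul_le_mul_of_nonneg_right h1 (hlt s hs').le
      refine div_nonneg ?_ (by positivity)
      norm_num
      linarith
    have h1 := hmono (Set.left_mem_Icc.2 zero_le_one) hτ hτ.1
    simp only [mul_zero, sub_zero, one_pow, div_one] at h1
    rwa [le_div_iff₀ (pow_pos (hlt τ hτ) 2)] at h1

theorem localNorm_mul_one_sub_le (hf : IsSelfConcordant f D)
    (hpos : ∀ x ∈ D, ∀ u : Vec n, u ≠ 0 → 0 < hess f x u u) {x y : Vec n} (hx : x ∈ D)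
    (hy : y ∈ D) (hr : localNorm f x (y - x) < 1) (u : Vec n) :
    localNorm f y u * (1 - localNorm f x (y - x)) ≤ localNorm f x u ∧
      localNorm f x u * (1 - localNorm f x (y - x)) ≤ localNorm f y u := by
  have h1 := hess_along_segment_bounds hf hpos hx (h := y - x) (by simpa using hy) hr
    (τ := 1) (by simp) u
  simp only [one_smul, add_sub_cancel, mul_one] at h1
  have h2 : ∀ z : Vec n, √(hess f z u u * (1 - localNorm f x (y - x)) ^ 2) =
      localNorm f z u * (1 - localNorm f x (y - x)) := fun z => by
    rw [Real.sqrt_mul' _ (sq_nonneg _), Real.sqrt_sq (by linarith)]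
    rfl
  exact ⟨(h2 y).symm.trans_le (Real.sqrt_le_sqrt h1.1),
    (h2 x).symm.trans_le (Real.sqrt_le_sqrt h1.2)⟩

theorem localNorm_add_le (hf : IsSelfConcordant f D)
    (hpos : ∀ x ∈ D, ∀ u : Vec n, u ≠ 0 → 0 < hess f x u u) {x : Vec n} (hx : x ∈ D)
    (u v : Vec n) : localNorm f x (u + v) ≤ localNorm f x u + localNorm f x v :=
  sqrt_apply_add_le (H := fderiv ℝ (fderiv ℝ f) x)
    (fderiv_fderiv_symm hf.isOpen_dom hf.contDiffOn hx) (hpos x hx) u v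

end SelfConcordant

end ProxNewton
-- Error of an inexact proximal-Newton step
namespace ProxNewton

variable {n : ℕ} {f : Vec n → ℝ} {D : Set (Vec n)} {g : Vec n → EReal}

theorem IsProperClosedConvex.segment_le (hg : IsProperClosedConvex g) {x y : Vec n}
    (hx : g x < ⊤) (hy : g y < ⊤) {θ : ℝ} (hθ : θ ∈ Set.Icc (0 : ℝ) 1) :
    g (x + θ • (y - x)) < ⊤ ∧
      (g (x + θ • (y - x))).toReal ≤ (g x).toReal + θ * ((g y).toReal - (g x).toReal) := by
  have mem : ∀ z, g z < ⊤ → (z, (g z).toReal) ∈ {p : Vec n × ℝ | g p.1 ≤ (p.2 : EReal)} :=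
    fun z hz => (EReal.coe_toReal hz.ne (hg.ne_bot z)).ge
  have h1 := hg.convex_epigraph.add_smul_sub_mem (mem x hx) (mem y hy) hθ
  have h2 : g (x + θ • (y - x)) ≤
      (((g x).toReal + θ * ((g y).toReal - (g x).toReal) : ℝ) : EReal) := h1
  have h3 : g (x + θ • (y - x)) < ⊤ := h2.trans_lt (EReal.coe_lt_top _)
  refine ⟨h3, ?_⟩
  rw [← EReal.coe_toReal h3.ne (hg.ne_bot _)] at h2
  exact_mod_cast h2

theorem domF_segment_mem (hD : Convex ℝ D) (hg : IsProperClosedConvex g) {x y : Vec n}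
    (hx : x ∈ domF D g) (hy : y ∈ domF D g) {θ : ℝ} (hθ : θ ∈ Set.Icc (0 : ℝ) 1) :
    x + θ • (y - x) ∈ domF D g :=
  ⟨hD.add_smul_sub_mem hx.1 hy.1 hθ, (hg.segment_le hx.2 hy.2 hθ).1⟩

/-- First order optimality condition for `F(·; t)`. -/
theorem IsExactSolution.neg_fderiv_le (hf : IsSelfConcordant f D) (hg : IsProperClosedConvex g)
    {t : ℝ} (ht : 0 < t) {xs y : Vec n} (hxs : IsExactSolution f D g t xs) (hy : y ∈ domF D g) :
    -fderiv ℝ f xs (y - xs) ≤ t⁻¹ * ((g y).toReal - (g xs).toReal) := by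
  set G := t⁻¹ * ((g y).toReal - (g xs).toReal)
  have hxs0 : xs + (0 : ℝ) • (y - xs) ∈ D := by simpa using hxs.1.1
  have hd : HasDerivAt (fun θ : ℝ => f (xs + θ • (y - xs)) + θ * G)
      (fderiv ℝ f xs (y - xs) + G) 0 := by
    have h1 := hasDerivAt_comp_line
      (differentiableAt_of_contDiffOn_three hf.isOpen_dom hf.contDiffOn hxs0).1
    simpa using h1.fun_add ((hasDerivAt_id (0 : ℝ)).mul_const G)
  -- Replacing `g` by its chord gives, up to a constant, a smooth majorant of the objective that is
  -- exact at `θ = 0`. It is therefore also minimal there, and no subgradient of `g` is needed.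
  have hmin : IsMinOn (fun θ : ℝ => f (xs + θ • (y - xs)) + θ * G) (Set.Icc 0 1) 0 := by
    intro θ hθ
    have h1 := hxs.2 _ (domF_segment_mem hf.convexOn.1 hg hxs.1 hy hθ)
    have h2 := mul_le_mul_of_nonneg_left (hg.segment_le hxs.1.2 hy.2 hθ).2 (inv_pos.2 ht).le
    simp only [objective] at h1
    simp only [Set.mem_ofPred_eq, zero_smul, add_zero, zero_mul]
    have e : t⁻¹ * ((g xs).toReal + θ * ((g y).toReal - (g xs).toReal)) =
        t⁻¹ * (g xs).toReal + θ * G := by simp only [G]; ring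
    linarith
  have h1 : 0 ≤ fderiv ℝ f xs (y - xs) + G := by
    have h := hmin.localize.hasFDerivWithinAt_nonneg (y := (1 : ℝ))
      hd.hasFDerivAt.hasFDerivWithinAt
      (mem_posTangentConeAt_of_segment_subset (by simp [segment_eq_Icc]))
    simpa using h
  linarith

/-- By the mean value theorem the remainder is a difference of two Hessians applied to `h, d`, which
the Cauchy–Schwarz lemma controls. Integration would give the sharper factor `r / (1 - r)`, but the
final constants leave room for this one. -/
theorem abs_gradient_remainder_le (hf : IsSelfConcordant f D)
    (hpos : ∀ x ∈ D, ∀ u : Vec n, u ≠ 0 → 0 < hess f x u u) {x h : Vec n} (hx : x ∈ D)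
    (hxh : x + h ∈ D) (hr : localNorm f x h < 1) (d : Vec n) :
    |fderiv ℝ f (x + h) d - fderiv ℝ f x d - hess f x h d| ≤
      (1 / (1 - localNorm f x h) ^ 2 - 1) * localNorm f x h * localNorm f x d := by
  have hseg : ∀ s ∈ Set.Icc (0 : ℝ) 1, x + s • h ∈ D := fun s hs =>
    hf.convexOn.1.add_smul_mem hx hxh hs
  have hd : ∀ s ∈ Set.Icc (0 : ℝ) 1, HasDerivAt (fun s : ℝ => fderiv ℝ f (x + s • h) d)
      (hess f (x + s • h) h d) s := fun s hs =>
    hasDerivAt_comp_line_apply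
      (differentiableAt_of_contDiffOn_three hf.isOpen_dom hf.contDiffOn (hseg s hs)).2.1
  obtain ⟨τ, hτ, hslope⟩ := exists_hasDerivAt_eq_slope (fun s : ℝ => fderiv ℝ f (x + s • h) d)
    (fun s => hess f (x + s • h) h d) zero_lt_one
    (fun s hs => (hd s hs).continuousAt.continuousWithinAt)
    (fun s hs => hd s (Set.Ioo_subset_Icc_self hs))
  have hτ' := Set.Ioo_subset_Icc_self hτ
  simp only [one_smul, zero_smul, add_zero, sub_zero, div_one] at hslope
  rw [← hslope]
  refine abs_apply_le_of_abs_diagonal_le (H := fderiv ℝ (fderiv ℝ f) x)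
    (B := fderiv ℝ (fderiv ℝ f) (x + τ • h) - fderiv ℝ (fderiv ℝ f) x)
    (fderiv_fderiv_symm hf.isOpen_dom hf.contDiffOn hx) (hpos x hx) (fun u v => ?_)
    (fun u => ?_) h d
  · simp only [sub_apply]
    rw [fderiv_fderiv_symm hf.isOpen_dom hf.contDiffOn hx,
      fderiv_fderiv_symm hf.isOpen_dom hf.contDiffOn (hseg τ hτ')]
  · obtain ⟨h1, h2⟩ := hess_along_segment_bounds hf hpos hx hxh hr hτ' u
    have hq := hess_self_nonneg hpos hx u
    have hqτ := hess_self_nonneg hpos (hseg τ hτ') u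
    have hr0 : 0 ≤ localNorm f x h := Real.sqrt_nonneg _
    change |hess f (x + τ • h) u u - hess f x u u| ≤ _ * hess f x u u
    generalize localNorm f x h = r at *
    generalize hess f (x + τ • h) u u = q' at *
    generalize hess f x u u = q at *
    have hρ : 0 < 1 - r := by linarith
    have hle : (1 - r) ^ 2 ≤ (1 - r * τ) ^ 2 := by
      have := mul_le_mul_of_nonneg_left hτ.2.le hr0
      exact pow_le_pow_left₀ hρ.le (by linarith) 2
    have h3 : q' ≤ 1 / (1 - r) ^ 2 * q := by
      rw [one_div, ← div_eq_inv_mul, le_div_iff₀ (by positivity)]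
      exact (mul_le_mul_of_nonneg_left hle hqτ).trans h1
    have h4 : q * (1 - r) ^ 2 ≤ q' := (mul_le_mul_of_nonneg_left hle hq).trans h2
    -- The lower deviation `1 - (1 - r)²` is dominated by the upper one `1 / (1 - r)² - 1`.
    have h5 : 2 ≤ 1 / (1 - r) ^ 2 + (1 - r) ^ 2 := by
      have hy : 0 < (1 - r) ^ 2 := by positivity
      generalize (1 - r) ^ 2 = y at *
      rw [div_add' _ _ _ hy.ne', le_div_iff₀ hy]
      nlinarith [sq_nonneg (y - 1)]
    rw [abs_le]
    constructor
    · have := mul_le_mul_of_nonneg_right h5 hq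
      linarith
    · linarith

/-- Distance from an inexact proximal-Newton step to the exact solution, in the local norm at the
starting point. -/
theorem IsInexactStep.localNorm_sub_le (hf : IsSelfConcordant f D)
    (hpos : ∀ x ∈ D, ∀ u : Vec n, u ≠ 0 → 0 < hess f x u u) (hg : IsProperClosedConvex g)
    {t δ : ℝ} (ht : 0 < t) (hδ : 0 ≤ δ) {xs x x' : Vec n} (hxs : IsExactSolution f D g t xs)
    (hx : x ∈ D) (hx' : IsInexactStep f D g t δ x x') (hr : localNorm f x (xs - x) < 1) :
    localNorm f x (x' - xs) ≤
      (1 / (1 - localNorm f x (xs - x)) ^ 2 - 1) * localNorm f x (xs - x) + δ := by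
  have hgrad := (abs_le.1 (abs_gradient_remainder_le hf hpos hx (h := xs - x)
    (by simpa using hxs.1.1) hr (x' - xs))).2
  rw [add_sub_cancel] at hgrad
  have hopt := hxs.neg_fderiv_le hf hg ht hx'.1
  set ε := (1 / (1 - localNorm f x (xs - x)) ^ 2 - 1) * localNorm f x (xs - x)
  have hε : 0 ≤ ε := by
    refine mul_nonneg ?_ (Real.sqrt_nonneg _)
    have h0 : 0 ≤ localNorm f x (xs - x) := Real.sqrt_nonneg _
    rw [sub_nonneg, le_div_iff₀ (pow_pos (by linarith) 2), one_mul]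
    exact pow_le_one₀ (by linarith) (by linarith)
  have hNN : localNorm f x (x' - xs) ^ 2 = hess f x (x' - xs) (x' - xs) :=
    Real.sq_sqrt (hess_self_nonneg hpos hx _)
  have hN0 : 0 ≤ localNorm f x (x' - xs) := Real.sqrt_nonneg _
  -- The step is compared with points on the segment from `x'` to `xs`, so no exact minimizer of the
  -- model is required.
  have hstep : ∀ θ ∈ Set.Icc (0 : ℝ) 1,
      θ * localNorm f x (x' - xs) ^ 2 - θ * (ε * localNorm f x (x' - xs))
        - θ ^ 2 * localNorm f x (x' - xs) ^ 2 / 2 ≤ δ ^ 2 / 2 := by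
    intro θ hθ
    have h1 := hx'.2 _ (domF_segment_mem hf.convexOn.1 hg hx'.1 hxs.1 hθ)
    have h2 := mul_le_mul_of_nonneg_left (hg.segment_le hx'.1.2 hxs.1.2 hθ).2 (inv_pos.2 ht).le
    have hq : quadModel f x x' - quadModel f x (x' + θ • (xs - x')) =
        θ * (fderiv ℝ f x (x' - xs) + hess f x (xs - x) (x' - xs))
          + θ * hess f x (x' - xs) (x' - xs) - θ ^ 2 / 2 * hess f x (x' - xs) (x' - xs) := by
      have e1 : x' - x = (x' - xs) + (xs - x) := by abel
      have e2 : x' + θ • (xs - x') - x = (x' - xs) + (xs - x) - θ • (x' - xs) := by module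
      have hsymm := fderiv_fderiv_symm hf.isOpen_dom hf.contDiffOn hx (x' - xs) (xs - x)
      unfold quadModel hess
      rw [e1, e2]
      generalize x' - xs = d at *
      generalize xs - x = h at *
      simp only [map_add, map_sub, map_smul, add_apply, sub_apply, smul_apply, smul_eq_mul]
      rw [hsymm]
      ring
    simp only [model] at h1
    rw [← hNN] at hq
    have h3 := mul_le_mul_of_nonneg_left hgrad hθ.1
    have h4 := mul_le_mul_of_nonneg_left hopt hθ.1
    linarith
  generalize localNorm f x (x' - xs) = N at *
  by_contra hlt
  rw [not_le] at hlt
  have hNpos : 0 < N := by linarith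
  -- This `θ` maximizes the left side of `hstep`, giving `(N - ε)² ≤ δ²`.
  have h1 := hstep ((N - ε) / N)
    ⟨div_nonneg (by linarith) hN0, (div_le_one hNpos).2 (by linarith)⟩
  have e : (N - ε) / N * N ^ 2 - (N - ε) / N * (ε * N) - ((N - ε) / N) ^ 2 * N ^ 2 / 2 =
      (N - ε) ^ 2 / 2 := by
    field_simp
    ring
  rw [e] at h1
  nlinarith

/-! ### Scalar inequalities behind the constants -/

/-- The left side increases with `Δ`. At the threshold, the slack is a multiple of the square `(1 -
c √β)²`. -/
theorem div_one_sub_add_le_of_le {β Δ c : ℝ} (hc : 1 ≤ c) (hβ : 0 < β)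
    (hΔ : Δ ≤ (√β - c * β) / (c + √β)) : Δ < 1 ∧ β / (1 - Δ) + Δ ≤ 1 / c * √β := by
  have hs : 0 < √β := Real.sqrt_pos.2 hβ
  have hss : √β ^ 2 = β := Real.sq_sqrt hβ.le
  generalize √β = s at *
  subst hss
  have hcs : 0 < c + s := by linarith
  have h0 : (s - c * s ^ 2) / (c + s) = 1 - c * (1 + s ^ 2) / (c + s) := by field_simp; ring
  rw [h0] at hΔ
  have h1 : c * (1 + s ^ 2) / (c + s) ≤ 1 - Δ := by linarith
  have hpos : 0 < c * (1 + s ^ 2) / (c + s) := by positivity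
  refine ⟨by linarith, ?_⟩
  have h2 : s ^ 2 / (1 - Δ) ≤ s ^ 2 / (c * (1 + s ^ 2) / (c + s)) := by gcongr
  have h3 : s ^ 2 / (c * (1 + s ^ 2) / (c + s)) + (1 - c * (1 + s ^ 2) / (c + s)) ≤ 1 / c * s := by
    have e : 1 / c * s - (s ^ 2 / (c * (1 + s ^ 2) / (c + s)) + (1 - c * (1 + s ^ 2) / (c + s))) =
        s ^ 2 * (1 - c * s) ^ 2 / (c * (1 + s ^ 2) * (c + s)) := by
      field_simp
      ring
    have : 0 ≤ s ^ 2 * (1 - c * s) ^ 2 / (c * (1 + s ^ 2) * (c + s)) := by positivity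
    linarith
  linarith

theorem newton_error_le {β δ lam r : ℝ} (hβ : β ≤ 0.15) (hβ0 : 0 < β)
    (hlam0 : 0 ≤ lam) (hlam : lam ≤ 1 / 2.581 * √β) (hδ : δ ≤ 0.075 * β) (hr0 : 0 ≤ r)
    (hr : r * (1 - lam) ≤ lam) :
    lam < 1 ∧ r < 1 ∧ (1 / (1 - r) ^ 2 - 1) * r + δ ≤ β * (1 - lam) := by
  -- `0.1502` rounds up `1 / 2.581²`. Then `0.151` bounds `√(0.1502 * 0.15)`, while `0.178` and
  -- `1.178` round up `0.151 / 0.849` and `1 / 0.849`.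
  have hsq : lam ^ 2 ≤ 0.1502 * β := by
    have h1 := pow_le_pow_left₀ hlam0 hlam 2
    rw [mul_pow, Real.sq_sqrt hβ0.le] at h1
    norm_num at h1 ⊢
    linarith
  have hl : lam ≤ 0.151 := by
    by_contra hc
    nlinarith
  have hr1 : r ≤ 0.178 := by
    by_contra hc
    nlinarith
  have hrl : r ≤ 1.178 * lam := by nlinarith
  have hk : 1 / (1 - r) ^ 2 - 1 ≤ 2.8 * r := by
    have hp : 0 < 1 - r := by linarith
    rw [sub_le_iff_le_add, div_le_iff₀ (by positivity)]
    have : 0 ≤ r * (0.8 - 4.6 * r + 2.8 * r ^ 2) := by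
      refine mul_nonneg hr0 ?_
      nlinarith
    nlinarith
  refine ⟨by linarith, by linarith, ?_⟩
  have h1 := mul_le_mul_of_nonneg_right hk hr0
  have h2 : r ^ 2 ≤ 1.178 ^ 2 * (0.1502 * β) := by
    have := pow_le_pow_left₀ hr0 hrl 2
    nlinarith
  -- Numerically, `2.8 * 1.178² * 0.1502 + 0.075 < 0.66`, well below `1 - 0.151`.
  nlinarith

end ProxNewton

theorem theorem4p1 {n : ℕ}
    (f : ProxNewton.Vec n → ℝ) (D : Set (ProxNewton.Vec n)) (g : ProxNewton.Vec n → EReal)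
    (ν : ℝ) (hf : ProxNewton.IsSelfConcordantBarrier f D ν)
    (hpos : ∀ x ∈ D, ∀ u : ProxNewton.Vec n, u ≠ 0 → 0 < ProxNewton.hess f x u u)
    (hg : ProxNewton.IsProperClosedConvex g)
    (β : ℝ) (hβ : β ∈ Set.Ioc (0 : ℝ) 0.15)
    (t t' : ℝ) (ht : 0 < t) (ht' : 0 < t')
    (xs xs' : ProxNewton.Vec n)
    (hxs : ProxNewton.IsExactSolution f D g t xs)
    (hxs' : ProxNewton.IsExactSolution f D g t' xs')
    (x x' : ProxNewton.Vec n) (hx : x ∈ ProxNewton.domF D g)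
    (δ : ℝ) (hδ0 : 0 ≤ δ) (hx' : ProxNewton.IsInexactStep f D g t' δ x x')
    (hδ : δ ≤ 0.075 * β)
    (hΔ : ProxNewton.localNorm f xs' (xs' - xs) ≤
      (Real.sqrt β - 2.581 * β) / (2.581 + Real.sqrt β))
    (hlam : ProxNewton.localNorm f xs (x - xs) ≤ β) :
    ProxNewton.localNorm f xs' (x - xs') ≤ 1 / 2.581 * Real.sqrt β ∧
      ProxNewton.localNorm f xs' (x' - xs') ≤ β ∧
      x' ∈ ProxNewton.quadRegion f D g xs' β := by
  obtain ⟨hβ0, hβ1⟩ := hβ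
  have hsc := hf.selfConcordant
  obtain ⟨hΔ1, hbound⟩ := ProxNewton.div_one_sub_add_le_of_le (by norm_num) hβ0 hΔ
  have hfirst : ProxNewton.localNorm f xs' (x - xs') ≤ 1 / 2.581 * Real.sqrt β := by
    rw [ProxNewton.localNorm_sub_comm] at hΔ1 hbound
    have h1 := (ProxNewton.localNorm_mul_one_sub_le hsc hpos hxs'.1.1 hxs.1.1 hΔ1 (x - xs)).2
    have h2 := ProxNewton.localNorm_add_le hsc hpos hxs'.1.1 (x - xs) (xs - xs')
    rw [sub_add_sub_cancel] at h2
    rw [← le_div_iff₀ (by linarith)] at h1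
    have h3 : ProxNewton.localNorm f xs (x - xs) /
        (1 - ProxNewton.localNorm f xs' (xs - xs')) ≤
          β / (1 - ProxNewton.localNorm f xs' (xs - xs')) := by
      gcongr
    linarith
  have hsecond : ProxNewton.localNorm f xs' (x' - xs') ≤ β := by
    have hlam0 : 0 ≤ ProxNewton.localNorm f xs' (x - xs') := Real.sqrt_nonneg _
    have hlt : ProxNewton.localNorm f xs' (x - xs') < 1 := by
      have h1 : Real.sqrt β ≤ 1 := Real.sqrt_le_one.2 (by linarith)
      norm_num at hfirst ⊢
      linarith
    -- Used in both directions: to bound `‖x - xs'‖_x` by `λ / (1 - λ)`, and to bring the step error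
    -- back to the norm at `xs'`.
    have hcmp := ProxNewton.localNorm_mul_one_sub_le hsc hpos hxs'.1.1 hx.1 hlt
    have hr := (hcmp (x - xs')).1
    rw [ProxNewton.localNorm_sub_comm f x] at hr
    obtain ⟨_, hr1, herr⟩ := ProxNewton.newton_error_le hβ1 hβ0 hlam0 hfirst hδ
      (Real.sqrt_nonneg _) hr
    have h1 := hx'.localNorm_sub_le hsc hpos hg ht' hδ0 hxs' hx.1 hr1
    have h2 := (hcmp (x' - xs')).2
    exact le_of_mul_le_mul_right (h2.trans (h1.trans herr)) (by linarith)
  exact ⟨hfirst, hsecond, hx'.1, hsecond⟩
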